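/- Let $k$ and $d_1,\dots,d_k$ be integers with $k\ge 1$ and $d_i\ge 2$ for all $i$. Identify $S^d\mathbb{C}^2$ with the space of complex homogeneous polynomials of degree $d$ in two variables $x,y$, write $[x],[y]\in\mathbb{P}^1=\mathbb{P}(\mathbb{C}^2)$ for the two coordinate points (lines spanned by the linear forms $x$, $y$), and let $W_d=x^{d-1}y\in S^d\mathbb{C}^2$. Let $$\nu_{d_1,\dots,d_k}:(\mathbb{P}^1)^k\to\mathbb{P}\big(S^{d_1}\mathbb{C}^2\otimes\cdots\otimes S^{d_k}\mathbb{C}^2\big),\qquad ([v_1],\dots,[v_k])\mapsto[v_1^{d_1}\otimes\cdots\otimes v_k^{d_k}]$$ be the Segre–Veronese embedding, let $X=\mathscr{V}_{d_1,\dots,d_k}$ be its image, and let $T=[W_{d_1}\otimes\cdots\otimes W_{d_k}]$. Let $r$ be the $X$-rank of $T$, i.e. the least integer such that $T$ lies in the projective span of $r$ points of $X$, let $X^{(r)}=X^{r}/\mathfrak{S}_r$ be the $r$-th symmetric power of $X$ with its Zariski topology, and let $$\mathcal{S}(T,X)=\{\{x_1,\dots,x_r\}\in X^{(r)} : T\in\langle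 x_1,\dots,x_r\rangle\}$$ with the subspace topology. Let $\Gamma$ be any irreducible component of $\mathcal{S}(T,X)$. Then $\dim\Gamma\ge k$, and for every $p=(p_1,\dots,p_k)\in(\mathbb{P}^1)^k$ with $p_i\neq[x]$ and $p_i\ne[y]$ for all $i$ there exists $A\in\Gamma$ with $\nu_{d_1,\dots,d_k}(p)\in A$. -/

import Mathlib

open MvPolynomial
open scoped LinearAlgebra.Projectivization TensorProduct

noncomputable section

namespace WStates

/-! ### Zariski topology and symmetric powers of subsets of a projective space -/

section Zariski

variable {V : Type*} [AddCommGroup V] [Module ℂ V]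

/-- `f` is a multihomogeneous polynomial function on `V × ⋯ × V` (`r` factors): it lies in the
algebra generated by the linear functionals, and it is homogeneous of some degree `e i` in the
`i`-th vector, for each `i`. -/
def IsMultiform {r : ℕ} (f : (Fin r → V) → ℂ) : Prop :=
  f ∈ Algebra.adjoin ℂ
      (Set.range fun φ : Module.Dual ℂ (Fin r → V) => (fun v => φ v : (Fin r → V) → ℂ)) ∧
    ∃ e : Fin r → ℕ, ∀ (c : Fin r → ℂ) (v : Fin r → V),
      f (fun i => c i • v i) = (∏ i, c i ^ e i) * f v

/-- The Zariski topology on `ℙ V × ⋯ × ℙ V` (`r` factors): the basic open sets are the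
nonvanishing loci of the multihomogeneous polynomials. -/
@[reducible] def zariskiProd (V : Type*) [AddCommGroup V] [Module ℂ V] (r : ℕ) :
    TopologicalSpace (Fin r → ℙ ℂ V) :=
  TopologicalSpace.generateFrom
    {U | ∃ f : (Fin r → V) → ℂ, IsMultiform f ∧ U = {p | f (fun i => (p i).rep) ≠ 0}}

/-- The `r`-th symmetric power `X^{(r)} = X^r / 𝔖_r` of `X ⊆ ℙ V`: its points are the unordered
`r`-tuples of points of `X`. -/
def SymmetricPower (X : Set (ℙ ℂ V)) (r : ℕ) : Type _ := Sym X r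

/-- The quotient map `X^r → X^{(r)}`. -/
def SymmetricPower.proj (X : Set (ℙ ℂ V)) (r : ℕ) (x : Fin r → X) : SymmetricPower X r :=
  (⟨Finset.univ.val.map x, by simp⟩ : Sym X r)

/-- The set of points of `ℙ V` occurring in an element of `X^{(r)}`. -/
def SymmetricPower.points {X : Set (ℙ ℂ V)} {r : ℕ} (A : SymmetricPower X r) : Set (ℙ ℂ V) :=
  {q | ∃ h : q ∈ X, (⟨q, h⟩ : X) ∈ (show Sym X r from A)}

/-- The Zariski topology on `X^{(r)}`: the quotient topology of the topology that `X^r` inherits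
from `ℙ V × ⋯ × ℙ V`. -/
instance (X : Set (ℙ ℂ V)) (r : ℕ) : TopologicalSpace (SymmetricPower X r) :=
  TopologicalSpace.coinduced (SymmetricPower.proj X r)
    (TopologicalSpace.induced (fun x : Fin r → X => fun i => (x i : ℙ ℂ V)) (zariskiProd V r))

/-- The `X`-rank of `p`: the least `r` such that `p` lies in the projective span of `r` points
of `X`. -/
def xRank (X : Set (ℙ ℂ V)) (p : ℙ ℂ V) : ℕ :=
  sInf {r | ∃ x : Fin r → X,
    p ∈ Projectivization.Subspace.span (Set.range fun i => (x i : ℙ ℂ V))}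

/-- `𝒮(p, X)`: the set of all `{x_1, …, x_r} ∈ X^{(r)}`, where `r` is the `X`-rank of `p`, whose
projective span contains `p`. It carries the subspace topology. -/
def rankDecompositions (X : Set (ℙ ℂ V)) (p : ℙ ℂ V) : Set (SymmetricPower X (xRank X p)) :=
  {A | p ∈ Projectivization.Subspace.span A.points}

end Zariski

/-! ### Partially symmetric tensors, the Segre-Veronese variety and `W`-states -/

/-- `S^d ℂ²`, as the space of homogeneous polynomials of degree `d` in `x = X 0` and `y = X 1`. -/
abbrev BinaryForm (d : ℕ) : Type := homogeneousSubmodule (Fin 2) ℂ d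

/-- The space `S^{d_1} ℂ² ⊗ ⋯ ⊗ S^{d_k} ℂ²`. -/
abbrev PartSymTensor {k : ℕ} (d : Fin k → ℕ) : Type := ⨂[ℂ] i, BinaryForm (d i)

/-- The linear form `v 0 * x + v 1 * y` attached to `v ∈ ℂ²`. -/
def linearForm (v : Fin 2 → ℂ) : MvPolynomial (Fin 2) ℂ := C (v 0) * X 0 + C (v 1) * X 1

theorem linearForm_isHomogeneous (v : Fin 2 → ℂ) : (linearForm v).IsHomogeneous 1 :=
  ((isHomogeneous_X ℂ 0).C_mul _).add ((isHomogeneous_X ℂ 1).C_mul _)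

theorem linearForm_ne_zero {v : Fin 2 → ℂ} (hv : v ≠ 0) : linearForm v ≠ 0 := by
  intro h
  apply hv
  have h0 := congrArg (MvPolynomial.eval ![(1 : ℂ), 0]) h
  have h1 := congrArg (MvPolynomial.eval ![(0 : ℂ), 1]) h
  simp [linearForm] at h0 h1
  funext i
  fin_cases i <;> simp [h0, h1]

theorem linearForm_smul (c : ℂ) (v : Fin 2 → ℂ) : linearForm (c • v) = c • linearForm v := by
  simp [linearForm, MvPolynomial.smul_eq_C_mul]
  ring

/-- The power `v^d ∈ S^d ℂ²` of `v ∈ ℂ²`. -/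
def powerForm (d : ℕ) (v : Fin 2 → ℂ) : BinaryForm d :=
  ⟨linearForm v ^ d, by simpa using (linearForm_isHomogeneous v).pow d⟩

theorem powerForm_ne_zero (d : ℕ) {v : Fin 2 → ℂ} (hv : v ≠ 0) : powerForm d v ≠ 0 := by
  intro h
  exact pow_ne_zero d (linearForm_ne_zero hv) (congrArg Subtype.val h)

theorem powerForm_smul (d : ℕ) (c : ℂ) (v : Fin 2 → ℂ) :
    powerForm d (c • v) = c ^ d • powerForm d v := by
  apply Subtype.ext
  simp [powerForm, linearForm_smul, smul_pow]

theorem tprod_ne_zero {k : ℕ} {M : Fin k → Type*} [∀ i, AddCommGroup (M i)]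
    [∀ i, Module ℂ (M i)] (m : ∀ i, M i) (hm : ∀ i, m i ≠ 0) :
    PiTensorProduct.tprod ℂ m ≠ 0 := by
  have h : ∀ i, ∃ φ : Module.Dual ℂ (M i), φ (m i) ≠ 0 := fun i => by
    by_contra! hc
    exact hm i ((Module.forall_dual_apply_eq_zero_iff ℂ (m i)).1 hc)
  choose φ hφ using h
  intro h0
  have h1 := congrArg
    (PiTensorProduct.lift ((MultilinearMap.mkPiAlgebra ℂ (Fin k) ℂ).compLinearMap φ)) h0
  rw [PiTensorProduct.lift.tprod, map_zero] at h1
  simp only [MultilinearMap.compLinearMap_apply, MultilinearMap.mkPiAlgebra_apply] at h1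
  exact Finset.prod_ne_zero_iff.2 (fun i _ => hφ i) h1

/-- The Segre-Veronese map `ν_{d_1,…,d_k} : (ℙ¹)^k → ℙ(S^{d_1} ℂ² ⊗ ⋯ ⊗ S^{d_k} ℂ²)`, which sends
`([v_1], …, [v_k])` to `[v_1^{d_1} ⊗ ⋯ ⊗ v_k^{d_k}]` (see `segreVeronese_mk`). -/
def segreVeronese {k : ℕ} (d : Fin k → ℕ) (p : Fin k → ℙ ℂ (Fin 2 → ℂ)) :
    ℙ ℂ (PartSymTensor d) :=
  Projectivization.mk ℂ (PiTensorProduct.tprod ℂ fun i => powerForm (d i) (p i).rep)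
    (tprod_ne_zero _ fun i => powerForm_ne_zero (d i) (p i).rep_nonzero)

theorem segreVeronese_mk {k : ℕ} (d : Fin k → ℕ) (v : Fin k → Fin 2 → ℂ) (hv : ∀ i, v i ≠ 0) :
    segreVeronese d (fun i => Projectivization.mk ℂ (v i) (hv i)) =
      Projectivization.mk ℂ (PiTensorProduct.tprod ℂ fun i => powerForm (d i) (v i))
        (tprod_ne_zero _ fun i => powerForm_ne_zero (d i) (hv i)) := by
  choose a ha using fun i => Projectivization.exists_smul_eq_mk_rep ℂ (v i) (hv i)
  rw [segreVeronese, Projectivization.mk_eq_mk_iff']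
  refine ⟨∏ i, (a i : ℂ) ^ d i, ?_⟩
  rw [← MultilinearMap.map_smul_univ]
  congr 1
  funext i
  rw [← powerForm_smul, ← ha i]
  rfl

/-- The Segre-Veronese variety `𝒱_{d_1,…,d_k}`. -/
def segreVeroneseVariety {k : ℕ} (d : Fin k → ℕ) : Set (ℙ ℂ (PartSymTensor d)) :=
  Set.range (segreVeronese d)

/-- `W_d = x^{d-1} y ∈ S^d ℂ²`. -/
def wState (d : ℕ) (hd : 1 ≤ d) : BinaryForm d :=
  ⟨X 0 ^ (d - 1) * X 1, by
    have h := ((isHomogeneous_X ℂ (0 : Fin 2)).pow (d - 1)).mul (isHomogeneous_X ℂ (1 : Fin 2))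
    rwa [one_mul, Nat.sub_add_cancel hd] at h⟩

theorem wState_ne_zero (d : ℕ) (hd : 1 ≤ d) : wState d hd ≠ 0 := by
  intro h
  exact mul_ne_zero (pow_ne_zero (d - 1) (X_ne_zero (0 : Fin 2))) (X_ne_zero (1 : Fin 2))
    (congrArg Subtype.val h)

/-- The point `T = [W_{d_1} ⊗ ⋯ ⊗ W_{d_k}]` of `ℙ(S^{d_1} ℂ² ⊗ ⋯ ⊗ S^{d_k} ℂ²)`. -/
def wTensor {k : ℕ} (d : Fin k → ℕ) (hd : ∀ i, 1 ≤ d i) : ℙ ℂ (PartSymTensor d) :=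
  Projectivization.mk ℂ (PiTensorProduct.tprod ℂ fun i => wState (d i) (hd i))
    (tprod_ne_zero _ fun i => wState_ne_zero (d i) (hd i))

/-- The point `[x] ∈ ℙ¹`. -/
def pointX : ℙ ℂ (Fin 2 → ℂ) :=
  Projectivization.mk ℂ ![1, 0] fun h => one_ne_zero (congrFun h 0)

/-- The point `[y] ∈ ℙ¹`. -/
def pointY : ℙ ℂ (Fin 2 → ℂ) :=
  Projectivization.mk ℂ ![0, 1] fun h => one_ne_zero (congrFun h 1)

end WStates

end

open scoped Topology

noncomputable section

namespace WStates

/-! ### Irreducibility and Krull dimension -/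

section Irreducibility

variable {Y : Type*} [TopologicalSpace Y]

/-! The torus `(ℂˣ)^k` scales `y` in each factor. It preserves the Segre-Veronese variety and
multiplies each `W_d` by a scalar, so it fixes `T` and acts on the decompositions. Its orbits are
irreducible, so it preserves every irreducible component (`torusDecomp_mem`). The functional reading
off the coefficient of `x^{d-1} y` in every factor is nonzero on `T` but kills each point of the
variety having a coordinate `[x]` or `[y]`. Hence every decomposition contains some `ν(q)` with `q`
in the open torus orbit (`exists_segreVeronese_mem_points`), and moving `q` to `p`
(`exists_torusProj_eq`) gives the second claim. For the dimension, let the first `j` torus factors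
act on some `A ∈ Γ`, for `j = 0, …, k`. The closures of these orbits increase strictly: the next
coordinate of the points of `A` stays in a finite set until its own factor acts, and that factor
moves the coordinate of `q` out of this set (`exists_isClosed_orbit`). Irreducibility of orbits is
tested on punctured lines in the torus, along which multiforms become polynomials in one variable
(`continuous_torusDecomp_torusLine`). -/

theorem isIrreducible_of_forall_curve {Z : Set Y} (hne : Z.Nonempty)
    (h : ∀ a ∈ Z, ∀ b ∈ Z, ∃ W ⊆ Z, IsPreirreducible W ∧ a ∈ W ∧ b ∈ W) : IsIrreducible Z := by
  refine ⟨hne, ?_⟩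
  rintro U V hU hV ⟨a, haZ, haU⟩ ⟨b, hbZ, hbV⟩
  obtain ⟨W, hWZ, hW, ha, hb⟩ := h a haZ b hbZ
  obtain ⟨y, hyW, hy⟩ := hW U V hU hV ⟨a, ha, haU⟩ ⟨b, hb, hbV⟩
  exact ⟨y, hWZ hyW, hy⟩

/-- If a family of continuous self-maps, one of them the identity, has irreducible orbits, then it
preserves each irreducible component. -/
theorem mem_irreducibleComponent_of_orbits {G : Type*} (act : G → Y → Y) (e : G)
    (he : ∀ y, act e y = y) (hcont : ∀ g, Continuous (act g))
    (horb : ∀ y, IsIrreducible (Set.range fun g => act g y))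
    {Γ : Set Y} (hΓ : Γ ∈ irreducibleComponents Y) (g : G) {y : Y} (hy : y ∈ Γ) :
    act g y ∈ Γ := by
  -- The saturation of `Γ` is irreducible: two opens meeting it pull back to opens of `Γ` with a
  -- common point `w`, and then meet inside the orbit of `w`. Maximality of `Γ` concludes.
  let Z : Set Y := {z | ∃ g, ∃ y ∈ Γ, act g y = z}
  have hΓZ : Γ ⊆ Z := fun z hz => ⟨e, z, hz, he z⟩
  have hZ : IsIrreducible Z := by
    refine ⟨hΓ.1.nonempty.mono hΓZ, ?_⟩
    rintro U V hU hV ⟨-, ⟨a, u, hu, rfl⟩, hau⟩ ⟨-, ⟨b, v, hv, rfl⟩, hbv⟩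
    obtain ⟨w, hw, hwU, hwV⟩ := hΓ.1.isPreirreducible _ _ (hU.preimage (hcont a))
      (hV.preimage (hcont b)) ⟨u, hu, hau⟩ ⟨v, hv, hbv⟩
    obtain ⟨-, ⟨c, rfl⟩, hc⟩ := (horb w).isPreirreducible U V hU hV
      ⟨_, ⟨a, rfl⟩, hwU⟩ ⟨_, ⟨b, rfl⟩, hwV⟩
    exact ⟨_, ⟨c, w, hw, rfl⟩, hc⟩
  exact hΓ.2 hZ hΓZ ⟨g, y, hy, rfl⟩

/-- The closures form the chain; the separating sets `C` certify strictness, so no closure has to be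
computed. -/
theorem le_topologicalKrullDim_of_chain {k : ℕ} (Z : ℕ → Set Y) (hZ : ∀ j, IsIrreducible (Z j))
    (hmono : Monotone Z)
    (hC : ∀ j < k, ∃ C, IsClosed C ∧ Z j ⊆ C ∧ ¬ Z (j + 1) ⊆ C) :
    (k : WithBot ℕ∞) ≤ topologicalKrullDim Y := by
  let s : LTSeries (TopologicalSpace.IrreducibleCloseds Y) :=
    { length := k
      toFun := fun j => ⟨closure (Z j), (hZ j).closure, isClosed_closure⟩
      step := fun j => by
        obtain ⟨C, hCc, hj, hj'⟩ := hC j j.2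
        refine lt_of_le_not_ge (closure_mono (hmono ?_)) fun hle => hj' ?_
        · simp
        · refine (subset_closure.trans hle).trans (closure_minimal ?_ hCc)
          simpa using hj }
  exact Order.LTSeries.length_le_krullDim s

end Irreducibility

instance preirreducibleSpace_cofiniteTopology {I : Type*} [Infinite I] :
    PreirreducibleSpace (CofiniteTopology I) := by
  refine ⟨?_⟩
  rintro U V hU hV ⟨u, -, hu⟩ ⟨v, -, hv⟩
  have h := (CofiniteTopology.isOpen_iff.1 hU ⟨u, hu⟩).union (CofiniteTopology.isOpen_iff.1 hV ⟨v, hv⟩)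
  have hinf : Infinite (CofiniteTopology I) := Infinite.of_injective _ CofiniteTopology.of.injective
  obtain ⟨w, hw⟩ := h.exists_notMem
  simp only [Set.mem_union, Set.mem_compl_iff, not_or, not_not] at hw
  exact ⟨w, trivial, hw⟩

/-! ### Projective spaces, multiforms and symmetric powers -/

section Projective

variable {V : Type*} [AddCommGroup V] [Module ℂ V]

theorem map_mem_span (f : V →ₗ[ℂ] V) (hf : Function.Injective f) {S : Set (ℙ ℂ V)} {p : ℙ ℂ V}
    (hp : p ∈ Projectivization.Subspace.span S) :
    Projectivization.map f hf p ∈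
      Projectivization.Subspace.span (Projectivization.map f hf '' S) := by
  induction hp with
  | of x hx => exact Projectivization.Subspace.subset_span _ ⟨x, hx, rfl⟩
  | mem_add v w hv hw hvw _ _ h1 h2 =>
    simp only [Projectivization.map_mk, map_add] at h1 h2 ⊢
    exact Projectivization.Subspace.mem_add _ _ _ _ _ _ h1 h2

theorem apply_rep_mk_eq_zero (φ : V →ₗ[ℂ] ℂ) {v : V} (hv : v ≠ 0) :
    φ (Projectivization.mk ℂ v hv).rep = 0 ↔ φ v = 0 := by
  obtain ⟨a, ha⟩ := Projectivization.exists_smul_eq_mk_rep ℂ v hv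
  rw [← ha, Units.smul_def, map_smul]
  simp

theorem apply_rep_eq_zero_of_mem_span (φ : V →ₗ[ℂ] ℂ) {S : Set (ℙ ℂ V)}
    (hS : ∀ y ∈ S, φ y.rep = 0) {p : ℙ ℂ V} (hp : p ∈ Projectivization.Subspace.span S) :
    φ p.rep = 0 := by
  induction hp with
  | of x hx => exact hS x hx
  | mem_add v w hv hw hvw _ _ h1 h2 =>
    rw [apply_rep_mk_eq_zero] at h1 h2 ⊢
    rw [map_add, h1, h2, add_zero]

/-- Changing representatives multiplies `f` by a product of powers of units, so the basic open sets
do not depend on the chosen `rep`. -/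
theorem IsMultiform.apply_rep_ne_zero {r : ℕ} {f : (Fin r → V) → ℂ} (hf : IsMultiform f)
    (w : Fin r → V) (hw : ∀ l, w l ≠ 0) :
    f (fun l => (Projectivization.mk ℂ (w l) (hw l)).rep) ≠ 0 ↔ f w ≠ 0 := by
  choose a ha using fun l => Projectivization.exists_smul_eq_mk_rep ℂ (w l) (hw l)
  obtain ⟨-, e, he⟩ := hf
  have h := he (fun l => (a l : ℂ)) w
  have h' : (fun l => (a l : ℂ) • w l) =
      fun l => (Projectivization.mk ℂ (w l) (hw l)).rep := funext ha
  rw [h'] at h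
  rw [h]
  have : ∏ l, (a l : ℂ) ^ e l ≠ 0 :=
    Finset.prod_ne_zero_iff.2 fun l _ => pow_ne_zero _ (a l).ne_zero
  simp [this]

theorem IsMultiform.comp_linearMap {r : ℕ} {f : (Fin r → V) → ℂ} (hf : IsMultiform f)
    (g : V →ₗ[ℂ] V) : IsMultiform fun v => f fun l => g (v l) := by
  obtain ⟨hf, e, he⟩ := hf
  refine ⟨?_, e, fun c v => by simpa using he c fun l => g (v l)⟩
  clear he
  induction hf using Algebra.adjoin_induction with
  | mem f hf =>
    obtain ⟨φ, rfl⟩ := hf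
    exact Algebra.subset_adjoin ⟨φ.comp (g.compLeft (Fin r)), rfl⟩
  | algebraMap c => exact Subalgebra.algebraMap_mem _ c
  | add f₁ f₂ _ _ h₁ h₂ => exact add_mem h₁ h₂
  | mul f₁ f₂ _ _ h₁ h₂ => exact mul_mem h₁ h₂

theorem isMultiform_apply {r : ℕ} (φ : V →ₗ[ℂ] ℂ) (l : Fin r) :
    IsMultiform fun v : Fin r → V => φ (v l) := by
  refine ⟨Algebra.subset_adjoin ⟨φ.comp (LinearMap.proj l), rfl⟩, Pi.single l 1, fun c v => ?_⟩
  simp only [map_smul, smul_eq_mul]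
  rw [Finset.prod_eq_single l]
  · simp
  · intro b _ hb
    simp [hb]
  · simp

/-- A multiform is polynomial along every curve whose image under each linear functional is
polynomial. -/
theorem IsMultiform.exists_polynomial {r : ℕ} {f : (Fin r → V) → ℂ} (hf : IsMultiform f)
    (w : ℂ → Fin r → V)
    (hw : ∀ (l : Fin r) (φ : Module.Dual ℂ V), ∃ P : Polynomial ℂ, ∀ s, φ (w s l) = P.eval s) :
    ∃ P : Polynomial ℂ, ∀ s, f (w s) = P.eval s := by
  obtain ⟨hf, -⟩ := hf
  induction hf using Algebra.adjoin_induction with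
  | mem f hf =>
    obtain ⟨φ, rfl⟩ := hf
    choose P hP using fun l => hw l (φ.comp (LinearMap.single ℂ (fun _ : Fin r => V) l))
    refine ⟨∑ l, P l, fun s => ?_⟩
    rw [Polynomial.eval_finsetSum]
    simp only [← hP, LinearMap.comp_apply]
    rw [← map_sum]
    exact congrArg φ (LinearMap.sum_single_apply (fun _ : Fin r => V) (w s)).symm
  | algebraMap c => exact ⟨Polynomial.C c, fun s => by simp⟩
  | add f₁ f₂ _ _ h₁ h₂ =>
    obtain ⟨P, hP⟩ := h₁
    obtain ⟨Q, hQ⟩ := h₂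
    exact ⟨P + Q, fun s => by simp [hP, hQ]⟩
  | mul f₁ f₂ _ _ h₁ h₂ =>
    obtain ⟨P, hP⟩ := h₁
    obtain ⟨Q, hQ⟩ := h₂
    exact ⟨P * Q, fun s => by simp [hP, hQ]⟩

variable {X : Set (ℙ ℂ V)} {r : ℕ}

/-- The Zariski topology on `X^r`. -/
@[reducible] def prodTopology (X : Set (ℙ ℂ V)) (r : ℕ) : TopologicalSpace (Fin r → X) :=
  TopologicalSpace.induced (fun x : Fin r → X => fun i => (x i : ℙ ℂ V)) (zariskiProd V r)

theorem continuous_proj : Continuous[prodTopology X r, inferInstance] (SymmetricPower.proj X r) :=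
  continuous_coinduced_rng

theorem continuous_prodTopology_iff {I : Type*} [TopologicalSpace I] {g : I → Fin r → X} :
    Continuous[inferInstance, prodTopology X r] g ↔
      ∀ f : (Fin r → V) → ℂ, IsMultiform f →
        IsOpen {s | f (fun l => (g s l : ℙ ℂ V).rep) ≠ 0} := by
  rw [continuous_induced_rng, continuous_generateFrom_iff]
  constructor
  · intro h f hf
    exact h _ ⟨f, hf, rfl⟩
  · rintro h _ ⟨f, hf, rfl⟩
    exact h f hf

theorem isOpen_prodTopology {f : (Fin r → V) → ℂ} (hf : IsMultiform f) :
    IsOpen[prodTopology X r] {x | f (fun l => (x l : ℙ ℂ V).rep) ≠ 0} :=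
  ⟨_, TopologicalSpace.isOpen_generateFrom_of_mem ⟨f, hf, rfl⟩, rfl⟩

theorem proj_surjective : Function.Surjective (SymmetricPower.proj X r) := by
  rintro ⟨m, hm⟩
  induction m using Quotient.inductionOn with
  | h L =>
    have hL : L.length = r := hm
    subst hL
    refine ⟨L.get, Subtype.ext ?_⟩
    simp [SymmetricPower.proj]

theorem mem_points_proj {x : Fin r → X} {q : ℙ ℂ V} :
    q ∈ (SymmetricPower.proj X r x).points ↔ ∃ l, (x l : ℙ ℂ V) = q := by
  constructor
  · rintro ⟨hq, h⟩
    obtain ⟨l, -, hl⟩ := Multiset.mem_map.1 (show _ ∈ Finset.univ.val.map x from h)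
    exact ⟨l, congrArg Subtype.val hl⟩
  · rintro ⟨l, rfl⟩
    exact ⟨(x l).2, show _ ∈ Finset.univ.val.map x from
      Multiset.mem_map_of_mem x (Finset.mem_univ_val l)⟩

/-- The map of symmetric powers induced by a self-map of `X`. -/
def SymmetricPower.map (g : X → X) (A : SymmetricPower X r) : SymmetricPower X r :=
  Sym.map g (show Sym X r from A)

theorem SymmetricPower.map_proj (g : X → X) (x : Fin r → X) :
    SymmetricPower.map g (SymmetricPower.proj X r x) =
      SymmetricPower.proj X r fun l => g (x l) :=
  Subtype.ext (Multiset.map_map g x Finset.univ.val)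

theorem SymmetricPower.points_map (g : X → X) (A : SymmetricPower X r) :
    (A.map g).points = {q | ∃ x : X, (x : ℙ ℂ V) ∈ A.points ∧ (g x : ℙ ℂ V) = q} := by
  obtain ⟨x, rfl⟩ := proj_surjective A
  ext q
  rw [SymmetricPower.map_proj, mem_points_proj]
  constructor
  · rintro ⟨l, rfl⟩
    exact ⟨x l, mem_points_proj.2 ⟨l, rfl⟩, rfl⟩
  · rintro ⟨y, hy, rfl⟩
    obtain ⟨l, hl⟩ := mem_points_proj.1 hy
    exact ⟨l, by rw [Subtype.ext hl]⟩

/-- Continuity is checked on `X^r`, where composing a multiform with `g` in every slot gives a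
multiform. -/
theorem SymmetricPower.continuous_map (g : V →ₗ[ℂ] V) (hg : Function.Injective g)
    (gX : X → X) (h : ∀ x, (gX x : ℙ ℂ V) = Projectivization.map g hg x) :
    Continuous (SymmetricPower.map gX : SymmetricPower X r → SymmetricPower X r) := by
  refine continuous_coinduced_dom.2 ?_
  have hcomp : SymmetricPower.map gX ∘ SymmetricPower.proj X r =
      SymmetricPower.proj X r ∘ fun x l => gX (x l) :=
    funext fun x => SymmetricPower.map_proj gX x
  rw [hcomp]
  let _ := prodTopology X r
  refine continuous_proj.comp (continuous_prodTopology_iff.2 fun f hf => ?_)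
  convert isOpen_prodTopology (X := X) (hf.comp_linearMap g) using 1
  ext x
  have hx : ∀ l, (gX (x l) : ℙ ℂ V) = Projectivization.mk ℂ (g (x l : ℙ ℂ V).rep)
      (map_zero g ▸ hg.ne (x l : ℙ ℂ V).rep_nonzero) := fun l => by
    rw [h, ← Projectivization.map_mk g hg _ (x l : ℙ ℂ V).rep_nonzero, Projectivization.mk_rep]
  simp only [Set.mem_ofPred_eq, hx]
  exact hf.apply_rep_ne_zero _ _

theorem isClosed_setOf_apply_rep_eq_zero (φ : V →ₗ[ℂ] ℂ) (l : Fin r) :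
    IsClosed[prodTopology X r] {x | φ (x l : ℙ ℂ V).rep = 0} := by
  refine @IsClosed.mk _ (prodTopology X r) _ ?_
  exact isOpen_prodTopology (isMultiform_apply φ l)

/-- The set of all `A ∈ X^{(r)}` each of whose points lies in one of finitely many given linear
subspaces is closed. -/
theorem isClosed_setOf_points_subset {ι κ : Type*} [Finite ι] (φ : ι → κ → V →ₗ[ℂ] ℂ) :
    IsClosed {A : SymmetricPower X r | ∀ q ∈ A.points, ∃ a, ∀ c, φ a c q.rep = 0} := by
  refine isClosed_coinduced.2 ?_
  have h : (SymmetricPower.proj X r ⁻¹'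
      {A : SymmetricPower X r | ∀ q ∈ A.points, ∃ a, ∀ c, φ a c q.rep = 0}) =
      ⋂ l, ⋃ a, ⋂ c, {x | φ a c (x l : ℙ ℂ V).rep = 0} := by
    ext x
    simp [mem_points_proj]
  rw [h]
  let _ := prodTopology X r
  exact isClosed_iInter fun l => isClosed_iUnion_of_finite fun a => isClosed_iInter fun c =>
    isClosed_setOf_apply_rep_eq_zero (φ a c) l

end Projective

/-! ### The torus action on binary forms and partially symmetric tensors -/

section Torus

/-- The vector `(v 0, c * v 1)`. -/
def scaleVec (c : ℂ) (v : Fin 2 → ℂ) : Fin 2 → ℂ := ![v 0, c * v 1]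

theorem scaleVec_ne_zero {c : ℂ} (hc : c ≠ 0) {v : Fin 2 → ℂ} (hv : v ≠ 0) :
    scaleVec c v ≠ 0 := by
  intro h
  apply hv
  have h0 := congrFun h 0
  have h1 := congrFun h 1
  simp only [scaleVec, Matrix.cons_val_zero, Matrix.cons_val_one, Pi.zero_apply] at h0 h1
  funext i
  fin_cases i
  · exact h0
  · exact (mul_eq_zero.1 h1).resolve_left hc

/-- The substitution `y ↦ c * y` on binary forms of degree `d`. -/
def scaleForm (d : ℕ) (c : ℂ) : BinaryForm d →ₗ[ℂ] BinaryForm d :=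
  (aeval ![(X 0 : MvPolynomial (Fin 2) ℂ), C c * X 1]).toLinearMap.restrict fun p hp => by
    have h : (aeval ![(X 0 : MvPolynomial (Fin 2) ℂ), C c * X 1] p).IsHomogeneous (1 * d) :=
      IsHomogeneous.aeval hp _ fun i => by
        fin_cases i
        · exact isHomogeneous_X ℂ 0
        · exact (isHomogeneous_X ℂ 1).C_mul c
    rwa [one_mul] at h

theorem coe_scaleForm (d : ℕ) (c : ℂ) (p : BinaryForm d) :
    (scaleForm d c p : MvPolynomial (Fin 2) ℂ) =
      aeval ![(X 0 : MvPolynomial (Fin 2) ℂ), C c * X 1] (p : MvPolynomial (Fin 2) ℂ) := rfl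

theorem scaleForm_powerForm (d : ℕ) (c : ℂ) (v : Fin 2 → ℂ) :
    scaleForm d c (powerForm d v) = powerForm d (scaleVec c v) := by
  apply Subtype.ext
  simp [coe_scaleForm, powerForm, linearForm, scaleVec, algebraMap_eq]
  ring

theorem scaleForm_wState (d : ℕ) (hd : 1 ≤ d) (c : ℂ) :
    scaleForm d c (wState d hd) = c • wState d hd := by
  apply Subtype.ext
  simp [coe_scaleForm, wState, smul_eq_C_mul]
  ring

theorem scaleForm_comp (d : ℕ) (a b : ℂ) :
    scaleForm d a ∘ₗ scaleForm d b = scaleForm d (a * b) := by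
  have h : ((aeval ![(X 0 : MvPolynomial (Fin 2) ℂ), C a * X 1]).comp
      (aeval ![(X 0 : MvPolynomial (Fin 2) ℂ), C b * X 1]) :
        MvPolynomial (Fin 2) ℂ →ₐ[ℂ] MvPolynomial (Fin 2) ℂ) =
      aeval ![(X 0 : MvPolynomial (Fin 2) ℂ), C (a * b) * X 1] := by
    refine MvPolynomial.algHom_ext fun i => ?_
    fin_cases i
    · simp
    · simp [algebraMap_eq]
      ring
  refine LinearMap.ext fun p => Subtype.ext ?_
  exact DFunLike.congr_fun h (p : MvPolynomial (Fin 2) ℂ)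

theorem scaleForm_one (d : ℕ) : scaleForm d 1 = LinearMap.id := by
  refine LinearMap.ext fun p => Subtype.ext ?_
  have h : ![(X 0 : MvPolynomial (Fin 2) ℂ), C 1 * X 1] = X := by
    funext i
    fin_cases i <;> simp
  rw [coe_scaleForm, h, aeval_X_left]
  rfl

variable {k : ℕ} {d : Fin k → ℕ}

/-- The action of the torus `(ℂˣ)^k` on partially symmetric tensors. -/
def torusMap (d : Fin k → ℕ) (t : Fin k → ℂˣ) : PartSymTensor d →ₗ[ℂ] PartSymTensor d :=
  PiTensorProduct.map fun i => scaleForm (d i) (t i)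

theorem torusMap_one : torusMap d 1 = LinearMap.id := by
  simp [torusMap, scaleForm_one]

theorem torusMap_injective (t : Fin k → ℂˣ) : Function.Injective (torusMap d t) := by
  have h : torusMap d t⁻¹ ∘ₗ torusMap d t = LinearMap.id := by
    rw [torusMap, torusMap, ← PiTensorProduct.map_comp]
    simp [scaleForm_comp, scaleForm_one]
  exact Function.LeftInverse.injective (g := torusMap d t⁻¹) fun v => LinearMap.congr_fun h v

/-- The action of the torus on `ℙ(S^{d_1} ℂ² ⊗ ⋯ ⊗ S^{d_k} ℂ²)`. -/
def torusProj (d : Fin k → ℕ) (t : Fin k → ℂˣ) : ℙ ℂ (PartSymTensor d) → ℙ ℂ (PartSymTensor d) :=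
  Projectivization.map (torusMap d t) (torusMap_injective t)

theorem torusProj_one (y : ℙ ℂ (PartSymTensor d)) : torusProj d 1 y = y := by
  induction y using Projectivization.ind with
  | h v hv => simp [torusProj, Projectivization.map_mk, torusMap_one]

/-- Keeping the explicit vectors, rather than representatives of their classes, makes the dependence
on `t` polynomial. -/
theorem torusProj_segreVeronese (t : Fin k → ℂˣ) (p : Fin k → ℙ ℂ (Fin 2 → ℂ)) :
    torusProj d t (segreVeronese d p) =
      Projectivization.mk ℂ
        (PiTensorProduct.tprod ℂ fun i => powerForm (d i) (scaleVec (t i) (p i).rep))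
        (tprod_ne_zero _ fun i => powerForm_ne_zero (d i)
          (scaleVec_ne_zero (t i).ne_zero (p i).rep_nonzero)) := by
  simp only [torusProj, segreVeronese, Projectivization.map_mk, torusMap,
    PiTensorProduct.map_tprod, scaleForm_powerForm]

theorem torusProj_segreVeronese' (t : Fin k → ℂˣ) (p : Fin k → ℙ ℂ (Fin 2 → ℂ)) :
    torusProj d t (segreVeronese d p) = segreVeronese d fun i =>
      Projectivization.mk ℂ (scaleVec (t i) (p i).rep)
        (scaleVec_ne_zero (t i).ne_zero (p i).rep_nonzero) := by
  rw [torusProj_segreVeronese, segreVeronese_mk]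

theorem torusProj_wTensor (t : Fin k → ℂˣ) (hd : ∀ i, 1 ≤ d i) :
    torusProj d t (wTensor d hd) = wTensor d hd := by
  rw [torusProj, wTensor, Projectivization.map_mk, Projectivization.mk_eq_mk_iff']
  refine ⟨∏ i, (t i : ℂ), ?_⟩
  rw [← MultilinearMap.map_smul_univ, torusMap, PiTensorProduct.map_tprod]
  simp only [scaleForm_wState]

/-- The action of the torus on the Segre-Veronese variety. -/
def torusVariety (t : Fin k → ℂˣ) (x : segreVeroneseVariety d) : segreVeroneseVariety d :=
  ⟨torusProj d t x, by
    obtain ⟨p, hp⟩ := x.2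
    rw [← hp, torusProj_segreVeronese']
    exact ⟨_, rfl⟩⟩

theorem torusVariety_one (x : segreVeroneseVariety d) : torusVariety 1 x = x :=
  Subtype.ext (torusProj_one _)

/-- The action of the torus on the decompositions of `T`. -/
def torusDecomp (hd : ∀ i, 1 ≤ d i) (t : Fin k → ℂˣ)
    (A : rankDecompositions (segreVeroneseVariety d) (wTensor d hd)) :
    rankDecompositions (segreVeroneseVariety d) (wTensor d hd) :=
  ⟨SymmetricPower.map (torusVariety t) A.1, by
    have h := map_mem_span (torusMap d t) (torusMap_injective t) A.2
    rw [← torusProj, torusProj_wTensor] at h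
    refine Projectivization.Subspace.monotone_span ?_ h
    rintro _ ⟨q, hq, rfl⟩
    rw [SymmetricPower.points_map]
    exact ⟨⟨q, hq.1⟩, hq, rfl⟩⟩

theorem torusDecomp_one (hd : ∀ i, 1 ≤ d i)
    (A : rankDecompositions (segreVeroneseVariety d) (wTensor d hd)) :
    torusDecomp hd 1 A = A := by
  apply Subtype.ext
  obtain ⟨x, hx⟩ := proj_surjective A.1
  simp only [torusDecomp, ← hx, SymmetricPower.map_proj, torusVariety_one]

theorem continuous_torusDecomp (hd : ∀ i, 1 ≤ d i) (t : Fin k → ℂˣ) :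
    Continuous (torusDecomp hd t) :=
  ((SymmetricPower.continuous_map (torusMap d t) (torusMap_injective t) (torusVariety t)
    fun _ => rfl).comp continuous_subtype_val).subtype_mk _

theorem mem_points_torusDecomp (hd : ∀ i, 1 ≤ d i) (t : Fin k → ℂˣ)
    (A : rankDecompositions (segreVeroneseVariety d) (wTensor d hd))
    {q : ℙ ℂ (PartSymTensor d)} :
    q ∈ (torusDecomp hd t A).1.points ↔ ∃ y ∈ A.1.points, torusProj d t y = q := by
  rw [torusDecomp, SymmetricPower.points_map]
  constructor
  · rintro ⟨x, hx, rfl⟩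
    exact ⟨x, hx, rfl⟩
  · rintro ⟨y, hy, rfl⟩
    exact ⟨⟨y, hy.1⟩, hy, rfl⟩

end Torus

/-! ### Torus orbits are irreducible -/

section Curves

/-- Binomial theorem, with coefficients kept in `BinaryForm d` so that multilinear maps can be
expanded on the sum. -/
theorem exists_powerForm_add_smul (d : ℕ) (a b : Fin 2 → ℂ) :
    ∃ c : Fin (d + 1) → BinaryForm d,
      ∀ s : ℂ, powerForm d (a + s • b) = ∑ m : Fin (d + 1), s ^ (m : ℕ) • c m := by
  refine ⟨fun m => ⟨(d.choose m : ℂ) • (linearForm b ^ (m : ℕ) * linearForm a ^ (d - m)), ?_⟩,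
    fun s => Subtype.ext ?_⟩
  · refine Submodule.smul_mem _ _ ?_
    have h := ((linearForm_isHomogeneous b).pow m).mul ((linearForm_isHomogeneous a).pow (d - m))
    rwa [one_mul, one_mul, Nat.add_sub_cancel' (Nat.lt_succ_iff.1 m.2)] at h
  · have h : linearForm (a + s • b) = s • linearForm b + linearForm a := by
      simp [linearForm, smul_eq_C_mul]
      ring
    rw [Submodule.coe_sum]
    change linearForm (a + s • b) ^ d = ∑ m : Fin (d + 1), s ^ (m : ℕ) •
      (d.choose m : ℂ) • (linearForm b ^ (m : ℕ) * linearForm a ^ (d - m))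
    rw [h, add_pow, Finset.sum_range]
    refine Finset.sum_congr rfl fun m _ => ?_
    simp only [smul_eq_C_mul, mul_pow, map_pow, map_natCast]
    ring

theorem exists_polynomial_apply_sum {k : ℕ} {d : Fin k → ℕ} {M : Fin k → Type*}
    [∀ i, AddCommGroup (M i)] [∀ i, Module ℂ (M i)] (c : ∀ i, Fin (d i + 1) → M i)
    (φ : MultilinearMap ℂ M ℂ) :
    ∃ P : Polynomial ℂ, ∀ s : ℂ, φ (fun i => ∑ m : Fin (d i + 1), s ^ (m : ℕ) • c i m) = P.eval s := by
  refine ⟨∑ m : ∀ i, Fin (d i + 1), Polynomial.C (φ fun i => c i (m i)) *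
    Polynomial.X ^ (∑ i, (m i : ℕ)), fun s => ?_⟩
  rw [MultilinearMap.map_sum, Polynomial.eval_finsetSum]
  refine Finset.sum_congr rfl fun m _ => ?_
  rw [MultilinearMap.map_smul_univ, Finset.prod_pow_eq_pow_sum, Polynomial.eval_mul,
    Polynomial.eval_C, Polynomial.eval_pow, Polynomial.eval_X, smul_eq_mul, mul_comm]

variable {k : ℕ} {d : Fin k → ℕ}

theorem exists_polynomial_apply_tprod (a b : Fin k → Fin 2 → ℂ)
    (φ : Module.Dual ℂ (PartSymTensor d)) :
    ∃ P : Polynomial ℂ, ∀ s : ℂ,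
      φ (PiTensorProduct.tprod ℂ fun i => powerForm (d i) (a i + s • b i)) = P.eval s := by
  choose c hc using fun i => exists_powerForm_add_smul (d i) (a i) (b i)
  obtain ⟨P, hP⟩ := exists_polynomial_apply_sum c
    (φ.compMultilinearMap (PiTensorProduct.tprod ℂ))
  refine ⟨P, fun s => ?_⟩
  simp only [hc]
  exact hP s

/-- Each coordinate is affine in `s` and nonzero at `s = 0`, so it has at most one root. -/
theorem infinite_setOf_line_ne_zero (t t' : Fin k → ℂˣ) :
    {s : ℂ | ∀ i, (t i : ℂ) + s * (t' i - t i) ≠ 0}.Infinite := by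
  refine Set.Infinite.mono (s := (⋃ i, {s : ℂ | (t i : ℂ) + s * (t' i - t i) = 0})ᶜ) ?_ ?_
  · intro s hs i hi
    exact hs (Set.mem_iUnion.2 ⟨i, hi⟩)
  · refine (Set.finite_iUnion fun i => Set.Subsingleton.finite ?_).infinite_compl
    intro s hs s' hs'
    simp only [Set.mem_ofPred_eq] at hs hs'
    have h : (s - s') * ((t' i : ℂ) - t i) = 0 := by linear_combination hs - hs'
    rcases mul_eq_zero.1 h with h | h
    · exact sub_eq_zero.1 h
    · rw [h, mul_zero, add_zero] at hs
      exact absurd hs (t i).ne_zero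

/-- The torus element `t + s (t' - t)` on the line through `t` and `t'`. -/
def torusLine (t t' : Fin k → ℂˣ) (s : {s : ℂ | ∀ i, (t i : ℂ) + s * (t' i - t i) ≠ 0}) :
    Fin k → ℂˣ := fun i => Units.mk0 _ (s.2 i)

theorem continuous_torusDecomp_torusLine (hd : ∀ i, 1 ≤ d i) (t t' : Fin k → ℂˣ)
    (A : rankDecompositions (segreVeroneseVariety d) (wTensor d hd)) :
    Continuous fun s : CofiniteTopology {s : ℂ | ∀ i, (t i : ℂ) + s * (t' i - t i) ≠ 0} =>
      torusDecomp hd (torusLine t t' (CofiniteTopology.of.symm s)) A := by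
  refine Continuous.subtype_mk ?_ _
  obtain ⟨x, hx⟩ := proj_surjective A.1
  choose p hp using fun l => (x l).2
  simp only [← hx, SymmetricPower.map_proj]
  let _ := prodTopology (segreVeroneseVariety d) (xRank (segreVeroneseVariety d) (wTensor d hd))
  refine continuous_proj.comp (continuous_prodTopology_iff.2 fun f hf => ?_)
  -- `a + s • b` is the representative of `p l i` scaled by the torus element at parameter `s`.
  let a : Fin (xRank (segreVeroneseVariety d) (wTensor d hd)) → Fin k → Fin 2 → ℂ := fun l i => ![(p l i).rep 0, t i * (p l i).rep 1]
  let b : Fin (xRank (segreVeroneseVariety d) (wTensor d hd)) → Fin k → Fin 2 → ℂ := fun l i => ![0, (t' i - t i) * (p l i).rep 1]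
  obtain ⟨P, hP⟩ := hf.exists_polynomial
    (fun s l => PiTensorProduct.tprod ℂ fun i => powerForm (d i) (a l i + s • b l i))
    fun l φ => exists_polynomial_apply_tprod (a l) (b l) φ
  have key : ∀ s : {s : ℂ | ∀ i, (t i : ℂ) + s * (t' i - t i) ≠ 0},
      f (fun l => (torusVariety (torusLine t t' s) (x l) : ℙ ℂ (PartSymTensor d)).rep) ≠ 0 ↔
        P.eval (s : ℂ) ≠ 0 := by
    intro s
    have h : ∀ l i, a l i + (s : ℂ) • b l i = scaleVec (torusLine t t' s i) (p l i).rep := by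
      intro l i
      funext j
      fin_cases j
      · simp [a, b, scaleVec]
      · simp [a, b, scaleVec, torusLine]
        ring
    rw [← hP]
    simp only [h, torusVariety, ← hp, torusProj_segreVeronese]
    exact hf.apply_rep_ne_zero _ _
  rw [CofiniteTopology.isOpen_iff]
  rintro ⟨s₀, hs₀⟩
  -- A nonempty nonvanishing locus forces `P ≠ 0`, and its complement then lies in the finite root
  -- set.
  have hP0 : P ≠ 0 := by
    rintro rfl
    exact (key _).1 hs₀ (by simp)
  refine Set.Finite.of_finite_image (f := fun s => ((CofiniteTopology.of.symm s :
    {s : ℂ | ∀ i, (t i : ℂ) + s * (t' i - t i) ≠ 0}) : ℂ))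
    ((Polynomial.finite_setOfPred_isRoot hP0).subset ?_)
    (Subtype.val_injective.comp CofiniteTopology.of.symm.injective).injOn
  rintro _ ⟨s, hs, rfl⟩
  exact not_not.1 fun h => hs ((key _).2 h)

/-- The orbit of a decomposition under the subtorus acting on the first `j` factors is
irreducible. -/
theorem isIrreducible_orbit (hd : ∀ i, 1 ≤ d i) (j : ℕ)
    {Γ : Set (rankDecompositions (segreVeroneseVariety d) (wTensor d hd))} {A}
    (hA : ∀ t, torusDecomp hd t A ∈ Γ) :
    IsIrreducible {B : Γ | ∃ t : Fin k → ℂˣ, (∀ i : Fin k, j ≤ i → t i = 1) ∧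
      torusDecomp hd t A = B} := by
  refine isIrreducible_of_forall_curve ⟨⟨_, hA 1⟩, 1, fun _ _ => rfl, rfl⟩ ?_
  rintro ⟨-, ha⟩ ⟨t, ht, rfl⟩ ⟨-, hb⟩ ⟨t', ht', rfl⟩
  have := (infinite_setOf_line_ne_zero t t').to_subtype
  have hc := (continuous_torusDecomp_torusLine hd t t' A).subtype_mk fun s => hA _
  -- The parameters `0` and `1` give `t` and `t'`; a coordinate equal to `1` at both ends is `1`
  -- along the line.
  refine ⟨_, ?_, ((PreirreducibleSpace.isPreirreducible_univ).image _ hc.continuousOn),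
    ⟨CofiniteTopology.of ⟨0, fun i => by simp⟩, trivial, ?_⟩,
    ⟨CofiniteTopology.of ⟨1, fun i => by simp⟩, trivial, ?_⟩⟩
  · rintro _ ⟨s, -, rfl⟩
    refine ⟨_, fun i hi => Units.ext ?_, rfl⟩
    simp [torusLine, ht i hi, ht' i hi]
  · refine Subtype.ext (congrArg (fun u => torusDecomp hd u A) (funext fun i => Units.ext ?_))
    simp [torusLine]
  · refine Subtype.ext (congrArg (fun u => torusDecomp hd u A) (funext fun i => Units.ext ?_))
    simp [torusLine]

end Curves

/-! ### Linear functionals detecting the coordinates of a point -/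

section Functionals

variable {k : ℕ} {d : Fin k → ℕ}

/-- The tensor product of linear functionals. -/
def prodFunctional (φ : ∀ i, BinaryForm (d i) →ₗ[ℂ] ℂ) : PartSymTensor d →ₗ[ℂ] ℂ :=
  PiTensorProduct.lift ((MultilinearMap.mkPiAlgebra ℂ (Fin k) ℂ).compLinearMap φ)

theorem apply_rep_mk_tprod_eq_zero (φ : PartSymTensor d →ₗ[ℂ] ℂ) {m : ∀ i, BinaryForm (d i)}
    (hm : PiTensorProduct.tprod ℂ m ≠ 0) :
    φ (Projectivization.mk ℂ (PiTensorProduct.tprod ℂ m) hm).rep = 0 ↔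
      φ (PiTensorProduct.tprod ℂ m) = 0 :=
  apply_rep_mk_eq_zero (V := PartSymTensor d) φ hm

theorem prodFunctional_tprod (φ : ∀ i, BinaryForm (d i) →ₗ[ℂ] ℂ) (m : ∀ i, BinaryForm (d i)) :
    prodFunctional φ (PiTensorProduct.tprod ℂ m) = ∏ i, φ i (m i) := by
  simp [prodFunctional]

/-- Evaluation of binary forms at `c`. -/
def evalForm (d : ℕ) (c : Fin 2 → ℂ) : BinaryForm d →ₗ[ℂ] ℂ :=
  (aeval c).toLinearMap ∘ₗ Submodule.subtype _

theorem evalForm_powerForm (d : ℕ) (c v : Fin 2 → ℂ) :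
    evalForm d c (powerForm d v) = (v 0 * c 0 + v 1 * c 1) ^ d := by
  simp [evalForm, powerForm, linearForm]

/-- The coefficient of `x^{d-1} y`. -/
def wCoeff (d : ℕ) : BinaryForm d →ₗ[ℂ] ℂ :=
  lcoeff ℂ (Finsupp.single 0 (d - 1) + Finsupp.single 1 1) ∘ₗ Submodule.subtype _

theorem wCoeff_wState (d : ℕ) (hd : 1 ≤ d) : wCoeff d (wState d hd) = 1 := by
  have h : (X 0 ^ (d - 1) * X 1 : MvPolynomial (Fin 2) ℂ) =
      monomial (Finsupp.single 0 (d - 1) + Finsupp.single 1 1) 1 := by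
    rw [X_pow_eq_monomial, X, monomial_mul, one_mul]
  simp [wCoeff, wState, h]

/-- The power is a multiple of `x^d` or `y^d`, and `d ≥ 2` separates these from `x^{d-1} y`; for `d
= 1` the form `y` would be `W_d` itself. -/
theorem wCoeff_powerForm_eq_zero {d : ℕ} (hd : 2 ≤ d) {v : Fin 2 → ℂ} (hv : v 0 = 0 ∨ v 1 = 0) :
    wCoeff d (powerForm d v) = 0 := by
  have hne : ∀ i : Fin 2, Finsupp.single i d ≠
      (Finsupp.single 0 (d - 1) + Finsupp.single 1 1 : Fin 2 →₀ ℕ) := by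
    intro i h
    have h0 := DFunLike.congr_fun h 0
    have h1 := DFunLike.congr_fun h 1
    fin_cases i
    · simp at h1
    · simp at h0
      omega
  rcases hv with h | h
  · change coeff _ (linearForm v ^ d) = 0
    rw [linearForm, h, C_0, zero_mul, zero_add, mul_pow, ← C_pow, coeff_C_mul, coeff_X_pow,
      if_neg (hne 1), mul_zero]
  · change coeff _ (linearForm v ^ d) = 0
    rw [linearForm, h, C_0, zero_mul, add_zero, mul_pow, ← C_pow, coeff_C_mul, coeff_X_pow,
      if_neg (hne 0), mul_zero]

/-- Every decomposition of `T` contains a point none of whose coordinates is `[x]` or `[y]`. -/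
theorem exists_segreVeronese_mem_points (hd : ∀ i, 2 ≤ d i) (hd' : ∀ i, 1 ≤ d i)
    (A : rankDecompositions (segreVeroneseVariety d) (wTensor d hd')) :
    ∃ q : Fin k → ℙ ℂ (Fin 2 → ℂ), segreVeronese d q ∈ A.1.points ∧
      ∀ i, (q i).rep 0 ≠ 0 ∧ (q i).rep 1 ≠ 0 := by
  by_contra! hcon
  have h0 := apply_rep_eq_zero_of_mem_span (prodFunctional fun i => wCoeff (d i))
    (fun y hy => ?_) A.2
  · replace h0 := (apply_rep_mk_tprod_eq_zero _ _).1 h0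
    rw [prodFunctional_tprod] at h0
    simp [wCoeff_wState] at h0
  · obtain ⟨q, rfl⟩ := hy.1
    obtain ⟨i, hi⟩ := hcon q hy
    refine (apply_rep_mk_tprod_eq_zero _ _).2 ?_
    rw [prodFunctional_tprod]
    refine Finset.prod_eq_zero (Finset.mem_univ i) (wCoeff_powerForm_eq_zero (hd i) ?_)
    exact or_iff_not_imp_left.2 hi

theorem rep_one_ne_zero {p : ℙ ℂ (Fin 2 → ℂ)} (hp : p ≠ pointX) : p.rep 1 ≠ 0 := by
  intro h
  apply hp
  rw [← p.mk_rep, pointX, Projectivization.mk_eq_mk_iff']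
  refine ⟨p.rep 0, funext fun i => ?_⟩
  fin_cases i <;> simp [h]

theorem rep_zero_ne_zero {p : ℙ ℂ (Fin 2 → ℂ)} (hp : p ≠ pointY) : p.rep 0 ≠ 0 := by
  intro h
  apply hp
  rw [← p.mk_rep, pointY, Projectivization.mk_eq_mk_iff']
  refine ⟨p.rep 1, funext fun i => ?_⟩
  fin_cases i <;> simp [h]

/-- Product evaluation functionals whose `j`-th evaluation point annihilates the linear form
`v`. -/
def coordFunctional (d : Fin k → ℕ) (j : Fin k) (v : Fin 2 → ℂ) (c : Fin k → Fin 2 → ℂ) :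
    PartSymTensor d →ₗ[ℂ] ℂ :=
  prodFunctional fun i => evalForm (d i) (Function.update c j ![-v 1, v 0] i)

theorem coordFunctional_tprod_eq_zero (j : Fin k) (hj : d j ≠ 0) (c w : Fin k → Fin 2 → ℂ) :
    coordFunctional d j (w j) c (PiTensorProduct.tprod ℂ fun i => powerForm (d i) (w i)) = 0 := by
  rw [coordFunctional, prodFunctional_tprod]
  refine Finset.prod_eq_zero (Finset.mem_univ j) ?_
  rw [evalForm_powerForm]
  simp only [Function.update_self, Matrix.cons_val_zero, Matrix.cons_val_one]
  rw [show w j 0 * -w j 1 + w j 1 * w j 0 = 0 by ring, zero_pow hj]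

/-- The determinant `h` says that `w j` and `v` are not proportional, so the form `w j` survives at
the zero of `v`; in the other factors any evaluation point off the zero of `w i` will do. Thus
linear equations on tensors cut out the condition `[w j] = [v]`. -/
theorem exists_coordFunctional_tprod_ne_zero (j : Fin k) (v : Fin 2 → ℂ)
    {w : Fin k → Fin 2 → ℂ} (hw : ∀ i, w i ≠ 0) (h : w j 1 * v 0 - w j 0 * v 1 ≠ 0) :
    ∃ c, coordFunctional d j v c
      (PiTensorProduct.tprod ℂ fun i => powerForm (d i) (w i)) ≠ 0 := by
  have hc : ∀ i, ∃ c : Fin 2 → ℂ, w i 0 * c 0 + w i 1 * c 1 ≠ 0 := fun i => by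
    by_contra! hc
    apply hw i
    have h0 := hc ![1, 0]
    have h1 := hc ![0, 1]
    simp at h0 h1
    funext l
    fin_cases l <;> simp [h0, h1]
  choose c hc using hc
  refine ⟨c, ?_⟩
  rw [coordFunctional, prodFunctional_tprod, Finset.prod_ne_zero_iff]
  intro i _
  rw [evalForm_powerForm]
  refine pow_ne_zero _ ?_
  by_cases hij : i = j
  · subst hij
    simpa [← sub_eq_neg_add] using h
  · simpa [hij] using hc i

end Functionals

/-! ### The main theorem -/

section Main

variable {k : ℕ} {d : Fin k → ℕ}

theorem torusDecomp_mem (hd : ∀ i, 1 ≤ d i)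
    {Γ : Set (rankDecompositions (segreVeroneseVariety d) (wTensor d hd))}
    (hΓ : Γ ∈ irreducibleComponents (rankDecompositions (segreVeroneseVariety d) (wTensor d hd)))
    (t : Fin k → ℂˣ) {A} (hA : A ∈ Γ) : torusDecomp hd t A ∈ Γ := by
  refine mem_irreducibleComponent_of_orbits (torusDecomp hd) 1 (torusDecomp_one hd)
    (continuous_torusDecomp hd) (fun B => ?_) hΓ t hA
  -- With `j = k` no coordinate of `t` is constrained, so this is the full orbit.
  have h := (isIrreducible_orbit hd k (Γ := Set.univ) (A := B) fun t => trivial).image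
    Subtype.val continuous_subtype_val.continuousOn
  convert h using 1
  ext B'
  constructor
  · rintro ⟨t, rfl⟩
    exact ⟨⟨_, trivial⟩, ⟨t, fun i hi => absurd hi i.2.not_ge, rfl⟩, rfl⟩
  · rintro ⟨_, ⟨t, -, ht⟩, rfl⟩
    exact ⟨t, ht⟩

/-- Moving the `j`-th factor leaves a closed set containing the orbit under the subtorus acting on
the first `j` factors. -/
theorem exists_isClosed_orbit (hd : ∀ i, 1 ≤ d i)
    (A : rankDecompositions (segreVeroneseVariety d) (wTensor d hd))
    {q : Fin k → ℙ ℂ (Fin 2 → ℂ)} (hqA : segreVeronese d q ∈ A.1.points)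
    (hq : ∀ i, (q i).rep 0 ≠ 0 ∧ (q i).rep 1 ≠ 0) (j : Fin k) :
    ∃ C : Set (rankDecompositions (segreVeroneseVariety d) (wTensor d hd)), IsClosed C ∧
      (∀ t : Fin k → ℂˣ, t j = 1 → torusDecomp hd t A ∈ C) ∧
      ∃ u : ℂˣ, torusDecomp hd (Function.update 1 j u) A ∉ C := by
  obtain ⟨x, hx⟩ := proj_surjective A.1
  choose p hp using fun l => (x l).2
  -- `C` requires every point to share its `j`-th coordinate with one of the finitely many points of
  -- `A`.
  refine ⟨_, (isClosed_setOf_points_subset fun l c =>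
    coordFunctional d j (p l j).rep c).preimage continuous_subtype_val, fun t ht => ?_, ?_⟩
  · intro y hy
    obtain ⟨z, hz, rfl⟩ := (mem_points_torusDecomp hd t A).1 hy
    rw [← hx, mem_points_proj] at hz
    obtain ⟨l, rfl⟩ := hz
    refine ⟨l, fun c => ?_⟩
    rw [← hp, torusProj_segreVeronese]
    refine (apply_rep_mk_tprod_eq_zero _ _).2 ?_
    have h := coordFunctional_tprod_eq_zero (d := d) j (Nat.one_le_iff_ne_zero.1 (hd j)) c
      fun i => scaleVec (t i) (p l i).rep
    have h1 : scaleVec (t j) (p l j).rep = (p l j).rep := by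
      funext i
      fin_cases i <;> simp [scaleVec, ht]
    rwa [h1] at h
  -- The excluded values are `0` and those `u` for which the scaled `q j` equals some `p l j`. If
  -- `(p l j).rep 0 = 0` the quotient is the junk value `0`; no `u` is bad then, because `(q j).rep
  -- 0 ≠ 0`.
  · obtain ⟨u, hu⟩ := (Set.finite_range fun l =>
      ((q j).rep 0 * (p l j).rep 1) / ((q j).rep 1 * (p l j).rep 0)).insert 0 |>.exists_notMem
    rw [Set.mem_insert_iff, not_or] at hu
    refine ⟨Units.mk0 u hu.1, fun hC => ?_⟩
    obtain ⟨l, hl⟩ := hC _ ((mem_points_torusDecomp hd _ A).2 ⟨_, hqA, rfl⟩)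
    simp only [torusProj_segreVeronese] at hl
    obtain ⟨c, hc⟩ := exists_coordFunctional_tprod_ne_zero (d := d) j (p l j).rep
      (w := fun i => scaleVec (Function.update (1 : Fin k → ℂˣ) j (Units.mk0 u hu.1) i) (q i).rep)
      (fun i => scaleVec_ne_zero (Units.ne_zero _) (q i).rep_nonzero) (by
        simp only [scaleVec, Function.update_self, Units.val_mk0, Matrix.cons_val_zero,
          Matrix.cons_val_one]
        intro h
        have hp0 : (p l j).rep 0 ≠ 0 := by
          intro h0
          rw [h0, mul_zero, zero_sub, neg_eq_zero] at h
          refine (p l j).rep_nonzero (funext fun i => ?_)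
          fin_cases i
          · exact h0
          · exact (mul_eq_zero.1 h).resolve_left (hq j).1
        refine hu.2 ⟨l, ?_⟩
        rw [div_eq_iff (mul_ne_zero (hq j).2 hp0)]
        linear_combination -h)
    exact hc ((apply_rep_mk_tprod_eq_zero _ _).1 (hl c))

theorem le_topologicalKrullDim_component (hd : ∀ i, 1 ≤ d i)
    {Γ : Set (rankDecompositions (segreVeroneseVariety d) (wTensor d hd))}
    (hΓ : Γ ∈ irreducibleComponents (rankDecompositions (segreVeroneseVariety d) (wTensor d hd)))
    {A} (hA : A ∈ Γ) {q : Fin k → ℙ ℂ (Fin 2 → ℂ)} (hqA : segreVeronese d q ∈ A.1.points)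
    (hq : ∀ i, (q i).rep 0 ≠ 0 ∧ (q i).rep 1 ≠ 0) :
    (k : WithBot ℕ∞) ≤ topologicalKrullDim Γ := by
  refine le_topologicalKrullDim_of_chain _
    (fun j => isIrreducible_orbit hd j fun t => torusDecomp_mem hd hΓ t hA) ?_ fun j hj => ?_
  · rintro j j' hjj' B ⟨t, ht, hB⟩
    exact ⟨t, fun i hi => ht i (hjj'.trans hi), hB⟩
  · obtain ⟨C, hC, hin, u, hu⟩ := exists_isClosed_orbit hd A hqA hq ⟨j, hj⟩
    refine ⟨_, hC.preimage continuous_subtype_val, ?_, fun hsub => hu ?_⟩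
    · rintro B ⟨t, ht, hB⟩
      rw [Set.mem_preimage, ← hB]
      exact hin t (ht ⟨j, hj⟩ le_rfl)
    · refine hsub (a := ⟨_, torusDecomp_mem hd hΓ _ hA⟩) ⟨_, fun i hi => ?_, rfl⟩
      rw [Function.update_of_ne, Pi.one_apply]
      rintro rfl
      exact absurd hi (Nat.not_succ_le_self j)

theorem exists_torusProj_eq {p q : Fin k → ℙ ℂ (Fin 2 → ℂ)}
    (hp : ∀ i, (p i).rep 0 ≠ 0 ∧ (p i).rep 1 ≠ 0) (hq : ∀ i, (q i).rep 0 ≠ 0 ∧ (q i).rep 1 ≠ 0) :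
    ∃ t, torusProj d t (segreVeronese d q) = segreVeronese d p := by
  -- The torus multiplies the slope `v 1 / v 0` by `t i`, so `t i` is the ratio of the slopes of `p
  -- i` and `q i`.
  refine ⟨fun i => Units.mk0 ((p i).rep 1 * (q i).rep 0 / ((p i).rep 0 * (q i).rep 1))
    (div_ne_zero (mul_ne_zero (hp i).2 (hq i).1) (mul_ne_zero (hp i).1 (hq i).2)), ?_⟩
  rw [torusProj_segreVeronese']
  congr 1
  funext i
  conv_rhs => rw [← (p i).mk_rep]
  rw [Projectivization.mk_eq_mk_iff']
  refine ⟨(q i).rep 0 / (p i).rep 0, funext fun l => ?_⟩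
  have h0 := (hp i).1
  have h1 := (hq i).2
  fin_cases l
  · simp [scaleVec]
    field_simp
  · simp [scaleVec]
    field_simp

end Main

end WStates

end

theorem mainTheorem12 (k : ℕ) (d : Fin k → ℕ) (hd : ∀ i, 2 ≤ d i)
    (Γ : Set (WStates.rankDecompositions (WStates.segreVeroneseVariety d)
      (WStates.wTensor d fun i => one_le_two.trans (hd i))))
    (hΓ : Γ ∈ irreducibleComponents (WStates.rankDecompositions (WStates.segreVeroneseVariety d)
      (WStates.wTensor d fun i => one_le_two.trans (hd i)))) :
    (k : WithBot ℕ∞) ≤ topologicalKrullDim Γ ∧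
      ∀ p : Fin k → ℙ ℂ (Fin 2 → ℂ),
        (∀ i, p i ≠ WStates.pointX ∧ p i ≠ WStates.pointY) →
          ∃ A ∈ Γ, WStates.segreVeronese d p ∈ A.1.points := by
  obtain ⟨A, hA⟩ := hΓ.1.nonempty
  obtain ⟨q, hqA, hq⟩ := WStates.exists_segreVeronese_mem_points hd _ A
  refine ⟨WStates.le_topologicalKrullDim_component _ hΓ hA hqA hq, fun p hp => ?_⟩
  obtain ⟨t, ht⟩ := WStates.exists_torusProj_eq (d := d)
    (fun i => ⟨WStates.rep_zero_ne_zero (hp i).2, WStates.rep_one_ne_zero (hp i).1⟩) hq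
  exact ⟨_, WStates.torusDecomp_mem _ hΓ t hA,
    (WStates.mem_points_torusDecomp _ t A).2 ⟨_, hqA, ht⟩⟩
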